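/- **Setting.** Let $\mathfrak g$ be a finite-dimensional simple complex Lie algebra with Cartan subalgebra $\mathfrak h$, simple roots $\alpha_1,\dots,\alpha_\ell$, highest root $\alpha_*$, and a Chevalley basis $\{E_\alpha\}\cup\{H_{\alpha_i}\}$, where $H_\alpha=[E_\alpha,E_{-\alpha}]$ and $\alpha(H_\alpha)=2$. Let $\mathfrak k$ be the real span of all $iH_\alpha$, $E_\alpha-E_{-\alpha}$, $i(E_\alpha+E_{-\alpha})$ (a compact real form), $\mathfrak a$ the real span of all $H_\alpha$, and $\mathfrak n$ the complex span of the $E_\alpha$ with $\alpha>0$. Assume that $\mathfrak g\subset\mathfrak{sl}(n,\mathbb C)$ is realized so that $\mathfrak k\subset\mathfrak{su}(n)$, $\mathfrak a$ consists of real diagonal matrices and $\mathfrak n$ of strictly upper triangular matrices, and that the connected subgroup $G\subset SL(n,\mathbb C)$ with Lie algebra $\mathfrak g$ is simply connected. Let $A,H\subset G$ be the connected subgroups with Lie algebras $\mathfrak a,\mathfrak h$, and let $K=G\cap SU(n)$. Let $w:\mathbb Z\to(0,\infty)$ satisfy $w(k+m)\le w(k)w(m)$, $w(-k)=w(k)$,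 $\lim_{k\to\infty}w(k)^{1/k}=1$, and $\lim_{k\to\infty}k^{-1/\lambda}\log w(k)=\infty$ for some $\lambda\in(1,2)$. Let $A_w$ be the algebra of functions $\sum_{k\in\mathbb Z}a_kz^k$ on $S^1$ with $\sum_k|a_k|w(k)<\infty$. Let $L\mathfrak g$ (resp. $LG$) be the set of maps $S^1\to\mathfrak g$ (resp. $S^1\to G$) with matrix entries in $A_w$. Put - $\tilde K=\{\gamma\in LG:\gamma(z)\in K\ \forall z\in S^1\}$ and $\tilde{\mathfrak k}=\{x\in L\mathfrak g: x(z)\in\mathfrak{su}(n)\ \forall z\in S^1\}$; - $\tilde{\mathfrak n}=\{x\in L\mathfrak g: x=\sum_{k\ge0}a_kz^k,\ a_0 \text{ strictly upper triangular}\}$ and $\tilde N=\{g\in LG: g=\sum_{k\ge0}a_kz^k,\ a_0 \text{ unipotent upper triangular}\}$; - $\tilde{\mathfrak b}=\mathfrak a+\tilde{\mathfrak n}$ and $\tilde B=A\tilde N$; - $\hat{\mathfrak k}=\tilde{\mathfrak k}\times i\mathbb R$ and $\hat{\mathfrak b}=\tilde{\mathfrak b}\times\mathbb R$, regarded as subspaces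 of the centrally extended loop algebra $L\mathfrak g\times\mathbb C$. For $\gamma\in LG$ the coadjoint (gauge) action is $$\mathrm{Ad}^*_\gamma(\phi,p)=\bigl(\gamma\phi\gamma^{-1}+p\,\gamma D\gamma^{-1},\,p\bigr),\qquad D=z\frac{d}{dz}.$$ The **Toda phase space** is the orbit of $\tilde B$ through $(\phi_0,1)$, where $$\phi_0(z)=\sum_{i=1}^\ell(E_{\alpha_i}+E_{-\alpha_i})+E_{\alpha_*}z^{-1}+E_{-\alpha_*}z ,$$ for the action $b\cdot x=\Pi\,\mathrm{Ad}^*_b\,x$, with $\Pi$ the projection onto $i\hat{\mathfrak k}$ along $i\hat{\mathfrak b}$. For $p\ne0$, the pair $(\phi,p)$ is **loop-regular** if the solution $f:\mathbb R\to G$ of $f'(t)f(t)^{-1}=\frac1{ip}\phi(e^{it})$, $f(0)=1$, is such that the centralizer of the monodromy $f(2\pi)$ in $G$ is conjugate in $G$ to the Cartan subgroup $H$. **Statement.** For every loop-regular $(\phi,1)$ in the Toda phase space there exist a loop $\gamma\in\tilde K$ and a constant $\mu\in\mathfrak a$ such that $$(\phi,1)=\mathrm{Ad}^*_\gamma(\mu,1).$$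 -/

import Mathlib

open scoped Matrix Topology
open Filter

attribute [local instance] LieRing.ofAssociativeRing

noncomputable section

namespace TodaLoop

/-- Complex `n × n` matrices. -/
abbrev Mat (n : ℕ) := Matrix (Fin n) (Fin n) ℂ

/-- The group `SL(n, ℂ)`. -/
abbrev SLn (n : ℕ) := Matrix.SpecialLinearGroup (Fin n) ℂ

/-! ### Weights and weighted Fourier series -/

/-- A symmetric submultiplicative weight on `ℤ`, of non-analytic type and rapidly increasing
at infinity (the limits at `-∞` follow from symmetry). -/
structure IsWeight (w : ℤ → ℝ) : Prop where
  pos : ∀ k, 0 < w k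
  submul : ∀ k m, w (k + m) ≤ w k * w m
  symm : ∀ k, w (-k) = w k
  nonanalytic : Tendsto (fun k : ℕ => (w k) ^ (1 / (k : ℝ))) atTop (𝓝 1)
  rapid : ∃ lam ∈ Set.Ioo (1 : ℝ) 2,
    Tendsto (fun k : ℕ => (k : ℝ) ^ (-1 / lam) * Real.log (w k)) atTop atTop

variable {n : ℕ}

/-- `f(z) = ∑ₖ aₖ zᵏ` on the unit circle, with `∑ₖ |aₖ| w(k) < ∞` in every matrix entry. -/
def HasWSeries (w : ℤ → ℝ) (a : ℤ → Mat n) (f : Circle → Mat n) : Prop :=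
  (∀ i j, Summable fun k => ‖a k i j‖ * w k) ∧
    ∀ z : Circle, HasSum (fun k : ℤ => (z : ℂ) ^ k • a k) (f z)

/-- The underlying set of the algebra `Mₙ(A_w)`, as matrix valued functions on the circle. -/
def MnA (w : ℤ → ℝ) : Set (Circle → Mat n) := {f | ∃ a, HasWSeries w a f}

/-- The derivation `D = z d/dz`, that is `-i d/dθ` at `z = e^{iθ}`, applied entrywise. -/
def loopD (f : Circle → Mat n) (z : Circle) : Mat n :=
  Matrix.of fun i j => -Complex.I * deriv (fun t : ℝ => f (z * Circle.exp t) i j) 0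

/-! ### Linear groups -/

/-- The subgroup of `SL(n, ℂ)` generated by the exponentials of the elements of `S`: when `S` is
a Lie algebra of trace-free matrices, this is the corresponding connected Lie subgroup. -/
def expGroup (S : Set (Mat n)) : Subgroup (SLn n) :=
  Subgroup.closure {g | ∃ X ∈ S, (g : Mat n) = NormedSpace.exp X}

/-- The connected linear group `G` with Lie algebra `𝔤`. -/
def G (𝔤 : LieSubalgebra ℂ (Mat n)) : Subgroup (SLn n) := expGroup (𝔤 : Set (Mat n))

variable {𝔤 : LieSubalgebra ℂ (Mat n)}

/-- The Cartan subgroup of `G` corresponding to the Cartan subalgebra `𝔥`. -/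
def cartanSubgroup (𝔥 : LieSubalgebra ℂ 𝔤) : Subgroup (SLn n) :=
  expGroup ((fun h : 𝔤 => (h : Mat n)) '' (𝔥 : Set 𝔤))

/-! ### Roots and Chevalley bases -/

/-- `α` is a root of `(𝔤, 𝔥)`. -/
def IsRoot (𝔥 : LieSubalgebra ℂ 𝔤) (α : Module.Dual ℂ 𝔥) : Prop :=
  α ≠ 0 ∧ ∃ x : 𝔤, x ≠ 0 ∧ ∀ h : 𝔥, ⁅(h : 𝔤), x⁆ = α h • x

/-- `α₁, …, α_ℓ` is a set of simple roots. -/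
structure IsSimpleRoots (𝔥 : LieSubalgebra ℂ 𝔤) {l : ℕ} (α : Fin l → Module.Dual ℂ 𝔥) :
    Prop where
  isRoot : ∀ i, IsRoot 𝔥 (α i)
  linearIndependent : LinearIndependent ℂ α
  decomp : ∀ β, IsRoot 𝔥 β →
    ∃ c : Fin l → ℕ, β = ∑ i, c i • α i ∨ β = -∑ i, c i • α i

/-- `β` is a positive root with respect to the simple roots `α`. -/
def IsPositiveRoot (𝔥 : LieSubalgebra ℂ 𝔤) {l : ℕ} (α : Fin l → Module.Dual ℂ 𝔥)
    (β : Module.Dual ℂ 𝔥) : Prop :=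
  IsRoot 𝔥 β ∧ ∃ c : Fin l → ℕ, β = ∑ i, c i • α i

/-- `θ` is the highest root with respect to the simple roots `α`. -/
def IsHighestRoot (𝔥 : LieSubalgebra ℂ 𝔤) {l : ℕ} (α : Fin l → Module.Dual ℂ 𝔥)
    (θ : Module.Dual ℂ 𝔥) : Prop :=
  IsRoot 𝔥 θ ∧ ∀ β, IsRoot 𝔥 β → ∃ c : Fin l → ℕ, θ - β = ∑ i, c i • α i

/-- `H_β = [E_β, E_{-β}]`. -/
def Hvec {𝔥 : LieSubalgebra ℂ 𝔤} (E : Module.Dual ℂ 𝔥 → 𝔤) (β : Module.Dual ℂ 𝔥) : 𝔤 :=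
  ⁅E β, E (-β)⁆

/-- `{E_β}` (`β` a root) and `{H_{αᵢ}}` form a Chevalley basis of `𝔤`. The values of `E` at
functionals that are not roots play no role. -/
structure IsChevalleyBasis (𝔥 : LieSubalgebra ℂ 𝔤) {l : ℕ} (α : Fin l → Module.Dual ℂ 𝔥)
    (E : Module.Dual ℂ 𝔥 → 𝔤) : Prop where
  root_space : ∀ β, IsRoot 𝔥 β → ∀ h : 𝔥, ⁅(h : 𝔤), E β⁆ = β h • E β
  normalized : ∀ β, IsRoot 𝔥 β → ∃ hm : Hvec E β ∈ 𝔥, β ⟨Hvec E β, hm⟩ = 2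
  structure_const : ∀ β γ, IsRoot 𝔥 β → IsRoot 𝔥 γ → IsRoot 𝔥 (β + γ) →
    ∃ c : ℂ, ⁅E β, E γ⁆ = c • E (β + γ) ∧ ⁅E (-β), E (-γ)⁆ = -c • E (-(β + γ))
  linearIndependent : LinearIndependent ℂ
    (Sum.elim (fun β : {β // IsRoot 𝔥 β} => E β.1) (fun i => Hvec E (α i)))
  span_eq_top : Submodule.span ℂ (Set.range
    (Sum.elim (fun β : {β // IsRoot 𝔥 β} => E β.1) (fun i => Hvec E (α i)))) = ⊤

section Realization

variable (𝔥 : LieSubalgebra ℂ 𝔤) {l : ℕ} (α : Fin l → Module.Dual ℂ 𝔥)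
  (E : Module.Dual ℂ 𝔥 → 𝔤)

/-- The compact real form `𝔨`. -/
def kAlg : Submodule ℝ (Mat n) :=
  Submodule.span ℝ {X | ∃ β, IsRoot 𝔥 β ∧
    (X = Complex.I • (Hvec E β : Mat n) ∨ X = (E β : Mat n) - (E (-β) : Mat n) ∨
      X = Complex.I • ((E β : Mat n) + (E (-β) : Mat n)))}

/-- The real Cartan `𝔞`: the real span of the `H_β`. -/
def aAlg : Submodule ℝ (Mat n) :=
  Submodule.span ℝ {X | ∃ β, IsRoot 𝔥 β ∧ X = (Hvec E β : Mat n)}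

/-- The nilpotent algebra `𝔫`: the complex span of the positive root vectors. -/
def nAlg : Submodule ℂ (Mat n) :=
  Submodule.span ℂ {X | ∃ β, IsPositiveRoot 𝔥 α β ∧ X = (E β : Mat n)}

/-- The linear realization is compatible with the Iwasawa decomposition of `sl(n, ℂ)`: `𝔨` is
skew-Hermitian, `𝔞` is real diagonal, `𝔫` is strictly upper triangular. -/
structure IsIwasawaCompatible : Prop where
  k_skew : ∀ X ∈ kAlg 𝔥 E, Xᴴ = -X
  a_diag : ∀ X ∈ aAlg 𝔥 E, ∃ d : Fin n → ℝ, X = Matrix.diagonal fun i => (d i : ℂ)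
  n_upper : ∀ X ∈ nAlg 𝔥 α E, ∀ i j, j ≤ i → X i j = 0

end Realization

/-! ### Loop algebras and loop groups -/

/-- The loop algebra `L𝔤`. -/
def LAlg (w : ℤ → ℝ) (𝔤 : LieSubalgebra ℂ (Mat n)) : Set (Circle → Mat n) :=
  {x | x ∈ MnA w ∧ ∀ z, x z ∈ 𝔤}

/-- The loop group `LG`. -/
def LGrp (w : ℤ → ℝ) (𝔤 : LieSubalgebra ℂ (Mat n)) : Set (Circle → SLn n) :=
  {g | (fun z => (g z : Mat n)) ∈ MnA w ∧ ∀ z, g z ∈ G 𝔤}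

/-- The algebra `𝔨̃` of loops in `L𝔤` with values in `su(n)`. -/
def kTilde (w : ℤ → ℝ) (𝔤 : LieSubalgebra ℂ (Mat n)) : Set (Circle → Mat n) :=
  {x | x ∈ LAlg w 𝔤 ∧ ∀ z, (x z)ᴴ = -x z}

/-- The group `K̃` of loops in `LG` with values in `SU(n)`. -/
def KTilde (w : ℤ → ℝ) (𝔤 : LieSubalgebra ℂ (Mat n)) : Set (Circle → SLn n) :=
  {g | g ∈ LGrp w 𝔤 ∧ ∀ z, (g z : Mat n) ∈ Matrix.unitaryGroup (Fin n) ℂ}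

/-- The algebra `𝔫̃` of loops `∑_{k ≥ 0} aₖ zᵏ` in `L𝔤` with `a₀` strictly upper triangular. -/
def nTilde (w : ℤ → ℝ) (𝔤 : LieSubalgebra ℂ (Mat n)) : Set (Circle → Mat n) :=
  {x | x ∈ LAlg w 𝔤 ∧ ∃ a, HasWSeries w a x ∧ (∀ k < 0, a k = 0) ∧
    ∀ i j, j ≤ i → a 0 i j = 0}

/-- The group `Ñ` of loops `∑_{k ≥ 0} aₖ zᵏ` in `LG` with `a₀` upper triangular unipotent. -/
def NTilde (w : ℤ → ℝ) (𝔤 : LieSubalgebra ℂ (Mat n)) : Set (Circle → SLn n) :=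
  {g | g ∈ LGrp w 𝔤 ∧ ∃ a, HasWSeries w a (fun z => (g z : Mat n)) ∧ (∀ k < 0, a k = 0) ∧
    (∀ i j, j < i → a 0 i j = 0) ∧ ∀ i, a 0 i i = 1}

/-- The Iwasawa complement `𝔟̃ = 𝔞 + 𝔫̃`. -/
def bTilde (w : ℤ → ℝ) (𝔥 : LieSubalgebra ℂ 𝔤) (E : Module.Dual ℂ 𝔥 → 𝔤) :
    Set (Circle → Mat n) :=
  {x | ∃ X ∈ aAlg 𝔥 E, ∃ y ∈ nTilde w 𝔤, ∀ z, x z = X + y z}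

/-- The group `B̃ = A Ñ`. -/
def BTilde (w : ℤ → ℝ) (𝔥 : LieSubalgebra ℂ 𝔤) (E : Module.Dual ℂ 𝔥 → 𝔤) :
    Set (Circle → SLn n) :=
  {g | ∃ a ∈ expGroup (aAlg 𝔥 E : Set (Mat n)), ∃ u ∈ NTilde w 𝔤, ∀ z, g z = a * u z}

/-! ### The centrally extended loop algebra and the Toda phase space -/

/-- Pairs `(φ, p)`; the centrally extended loop algebra consists of those with `φ ∈ L𝔤`. -/
abbrev Ext (n : ℕ) := (Circle → Mat n) × ℂ

/-- The coadjoint (gauge) action `Ad*_γ(φ, p) = (Ad_γ φ + p γ Dγ⁻¹, p)`. -/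
def gauge (γ : Circle → SLn n) (x : Ext n) : Ext n :=
  (fun z => (γ z : Mat n) * x.1 z * ((γ z)⁻¹ : SLn n) +
      x.2 • ((γ z : Mat n) * loopD (fun ζ => (((γ ζ)⁻¹ : SLn n) : Mat n)) z), x.2)

/-- `𝔨̂ = 𝔨̃ + iℝ`. -/
def kHat (w : ℤ → ℝ) (𝔤 : LieSubalgebra ℂ (Mat n)) : Set (Ext n) :=
  {x | x.1 ∈ kTilde w 𝔤 ∧ ∃ s : ℝ, x.2 = Complex.I * s}

/-- `𝔟̂ = 𝔟̃ + ℝ`. -/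
def bHat (w : ℤ → ℝ) (𝔥 : LieSubalgebra ℂ 𝔤) (E : Module.Dual ℂ 𝔥 → 𝔤) : Set (Ext n) :=
  {x | x.1 ∈ bTilde w 𝔥 E ∧ ∃ s : ℝ, x.2 = s}

/-- The base point `φ₀(z) = ∑ᵢ (E_{αᵢ} + E_{-αᵢ}) + E_θ z⁻¹ + E_{-θ} z`, `θ` the highest root. -/
def basePoint {𝔥 : LieSubalgebra ℂ 𝔤} {l : ℕ} (α : Fin l → Module.Dual ℂ 𝔥)
    (θ : Module.Dual ℂ 𝔥) (E : Module.Dual ℂ 𝔥 → 𝔤) (z : Circle) : Mat n :=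
  ∑ i, ((E (α i) : Mat n) + (E (-α i) : Mat n)) +
    (z : ℂ)⁻¹ • (E θ : Mat n) + (z : ℂ) • (E (-θ) : Mat n)

/-- The symmetric periodic Toda phase space: the coadjoint orbit of `B̂` through `(φ₀, 1)` in
`𝔨̂^⊥ = i𝔨̂`, that is, the set of all projections onto `i𝔨̂` along `𝔟̂^⊥ = i𝔟̂` of the elements
`Ad*_b(φ₀, 1)`. The group `B̂` acts through its quotient `B̃` by central elements. -/
def todaPhaseSpace (w : ℤ → ℝ) (𝔥 : LieSubalgebra ℂ 𝔤) {l : ℕ}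
    (α : Fin l → Module.Dual ℂ 𝔥) (θ : Module.Dual ℂ 𝔥) (E : Module.Dual ℂ 𝔥 → 𝔤) :
    Set (Ext n) :=
  {y | (∃ x ∈ kHat w 𝔤, y = Complex.I • x) ∧
    ∃ b ∈ BTilde w 𝔥 E, ∃ x ∈ bHat w 𝔥 E,
      gauge b (basePoint α θ E, 1) - y = Complex.I • x}

/-! ### Monodromy and loop-regularity -/

/-- `f : ℝ → G` solves the monodromy equation `f'(t) f(t)⁻¹ = (1 / (i p)) φ(e^{it})`, `f(0) = 1`.
The solution exists and is unique for every `(φ, p)` with `φ ∈ L𝔤` and `p ≠ 0`. -/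
def SolvesMonodromy (𝔤 : LieSubalgebra ℂ (Mat n)) (x : Ext n) (f : ℝ → SLn n) : Prop :=
  (∀ t, f t ∈ G 𝔤) ∧ f 0 = 1 ∧
    ∀ t i j, HasDerivAt (fun s => (f s : Mat n) i j)
      ((((1 / (Complex.I * x.2)) • x.1 (Circle.exp t)) * (f t : Mat n)) i j) t

/-- `m` is regular: its centralizer in `G` is conjugate in `G` to the Cartan subgroup. -/
def IsRegular (𝔥 : LieSubalgebra ℂ 𝔤) (m : SLn n) : Prop :=
  ∃ g ∈ G 𝔤, G 𝔤 ⊓ Subgroup.centralizer {m} =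
    (cartanSubgroup 𝔥).map (MulAut.conj g).toMonoidHom

/-- `(φ, p)` with `p ≠ 0` is loop-regular: its monodromy `f(2π)` is regular. -/
def LoopRegular (𝔥 : LieSubalgebra ℂ 𝔤) (x : Ext n) : Prop :=
  x.2 ≠ 0 ∧ ∃ f : ℝ → SLn n, SolvesMonodromy 𝔤 x f ∧ IsRegular 𝔥 (f (2 * Real.pi))

end TodaLoop

end

/-! This is a Floquet argument carried out inside the compact form. A point of the phase space has
`φ = i x` with `x` a skew-Hermitian loop in `𝔤`, so the monodromy equation reads `f' = x f`. Its
solution is therefore unitary with values in `G`, and `f(t + 2π) = f(t) M` with `M = f(2π)`.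

Loop-regularity together with unitarity lets `M` be diagonalized by `k ∈ K`: `M k = k exp(i z)` with
`z ∈ 𝔞` (`exists_unitary_conj_of_isRegular`). Put `μ = -z / (2π)` and `γ(e^{it}) = f(t) k exp(i t
μ)`. The last factor cancels the monodromy, so `γ` is a well-defined loop in `K`. From `γ' = x γ + i
γ μ` and `D = -i d/dt` one gets `γ Dγ⁻¹ = φ - γ μ γ⁻¹`, which is the claimed gauge identity.

The analytic point is that the entries of `γ` lie in `A_w`. They solve a linear system with
coefficients in `A_w`, so their Fourier coefficients satisfy `|k| s(k) ≤ (a * s)(k)` with `a`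
`w`-summable. For large `|k|` the factor `|k|` beats the weighted norm of `a`, and the high
frequencies are absorbed (`tsum_mul_weight_ne_top`, `summable_circleCoeff_of_linear_system`). -/

noncomputable section

namespace TodaLoop

/-! ### Absorption estimate for weighted sums -/

open scoped ENNReal in
/-- If `|k| s(k)` is dominated by the convolution of `s` with a `w`-summable sequence, where `w` is
submultiplicative, then `s` is itself `w`-summable. -/
theorem tsum_mul_weight_ne_top {s a w : ℤ → ℝ≥0∞} (hs : ∑' k, s k ≠ ∞)
    (ha : ∑' k, a k * w k ≠ ∞) (hwfin : ∀ k, w k ≠ ∞) (hw1 : ∀ k, 1 ≤ w k)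
    (hsub : ∀ k m, w (k + m) ≤ w k * w m)
    (hconv : ∀ k : ℤ, (k.natAbs : ℝ≥0∞) * s k ≤ ∑' m, a m * s (k - m)) :
    ∑' k, s k * w k ≠ ∞ := by
  -- `N ≥ 2C` makes the convolution term at most half of `N T` below; the extra `1` keeps `N`
  -- nonzero so that it can be cancelled.
  obtain ⟨N₀, hN₀⟩ := ENNReal.exists_nat_gt (r := 2 * ∑' k, a k * w k) (by finiteness)
  set C := ∑' k, a k * w k with hC
  set N := N₀ + 1 with hN
  have hCN : 2 * C ≤ (N : ℝ≥0∞) := hN₀.le.trans (by simp [hN])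
  set S := ∑ k ∈ Finset.Icc (-(N : ℤ)) N, s k * w k with hS
  have hsfin : ∀ k, s k ≠ ∞ := fun k => ENNReal.ne_top_of_tsum_ne_top hs k
  have hSfin : S ≠ ∞ := ENNReal.sum_ne_top.2 fun k _ => ENNReal.mul_ne_top (hsfin k) (hwfin k)
  -- Absorbing a term requires it to be finite beforehand, so the weight is truncated at `R`; the
  -- resulting bound `2 * S` does not depend on `R`.
  have key : ∀ R : ℝ≥0∞, 1 ≤ R → R ≠ ∞ → ∑' k, s k * min (w k) R ≤ 2 * S := by
    intro R hR hRfin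
    set v : ℤ → ℝ≥0∞ := fun k => min (w k) R with hv
    -- Truncation preserves submultiplicativity against the full weight, because `1 ≤ w`.
    have hvsub : ∀ k m, v k ≤ w m * v (k - m) := by
      intro k m
      simp only [hv]
      rcases le_total (w (k - m)) R with h | h
      · rw [min_eq_left h]
        refine (min_le_left _ _).trans ?_
        simpa using hsub m (k - m)
      · rw [min_eq_right h]
        exact (min_le_right _ _).trans (le_mul_of_one_le_left (zero_le) (hw1 m))
    set T := ∑' k, s k * v k with hT
    have hTfin : T ≠ ∞ := by
      refine ne_top_of_le_ne_top (ENNReal.mul_ne_top hs hRfin) ?_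
      rw [← ENNReal.tsum_mul_right]
      exact ENNReal.tsum_le_tsum fun k => by gcongr; exact min_le_right _ _
    have h1 : ∑' k : ℤ, (k.natAbs : ℝ≥0∞) * s k * v k ≤ C * T := by
      calc ∑' k : ℤ, (k.natAbs : ℝ≥0∞) * s k * v k
          ≤ ∑' k : ℤ, ∑' m : ℤ, (a m * w m) * (s (k - m) * v (k - m)) := by
            refine ENNReal.tsum_le_tsum fun k => ?_
            refine (mul_le_mul_left (hconv k) (v k)).trans ?_
            rw [← ENNReal.tsum_mul_right]
            refine ENNReal.tsum_le_tsum fun m => ?_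
            calc a m * s (k - m) * v k ≤ a m * s (k - m) * (w m * v (k - m)) := by
                  gcongr; exact hvsub k m
              _ = _ := by ring
        _ = ∑' m : ℤ, ∑' k : ℤ, (a m * w m) * (s (k - m) * v (k - m)) := ENNReal.tsum_comm
        _ = ∑' m : ℤ, (a m * w m) * T := by
            refine tsum_congr fun m => ?_
            rw [ENNReal.tsum_mul_left]
            congr 1
            exact (Equiv.subRight m).tsum_eq (fun k => s k * v k)
        _ = C * T := ENNReal.tsum_mul_right
    -- Low frequencies `|k| ≤ N` contribute at most `N * S`; for the others `N ≤ |k|` and `h1`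
    -- applies.
    have h2 : (N : ℝ≥0∞) * T ≤ N * S + C * T := by
      calc (N : ℝ≥0∞) * T = ∑' k, (N : ℝ≥0∞) * (s k * v k) := ENNReal.tsum_mul_left.symm
        _ ≤ ∑' k, ((if k ∈ Finset.Icc (-(N : ℤ)) N then (N : ℝ≥0∞) * (s k * w k) else 0) +
              (k.natAbs : ℝ≥0∞) * s k * v k) := by
            refine ENNReal.tsum_le_tsum fun k => ?_
            split_ifs with hk
            · refine le_add_right ?_
              gcongr
              exact min_le_left _ _
            · rw [zero_add, mul_assoc]
              gcongr
              simp only [Finset.mem_Icc] at hk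
              omega
        _ = N * S + ∑' k : ℤ, (k.natAbs : ℝ≥0∞) * s k * v k := by
            rw [ENNReal.tsum_add, hS, Finset.mul_sum]
            congr 1
            rw [tsum_eq_sum (s := Finset.Icc (-(N : ℤ)) N)]
            · exact Finset.sum_congr rfl fun k hk => by rw [if_pos hk]
            · intro k hk; rw [if_neg hk]
        _ ≤ _ := by gcongr
    -- Doubling `h2` replaces subtraction of `C * T` by cancellation of the finite quantity `N * T`.
    have h3 : (N : ℝ≥0∞) * T + N * T ≤ N * T + N * (2 * S) := by
      calc (N : ℝ≥0∞) * T + N * T ≤ (N * S + C * T) + (N * S + C * T) := add_le_add h2 h2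
        _ = (2 * C) * T + N * (2 * S) := by ring
        _ ≤ _ := by gcongr
    have h4 : (N : ℝ≥0∞) * T ≤ N * (2 * S) :=
      (ENNReal.add_le_add_iff_left (by finiteness)).1 h3
    exact (ENNReal.mul_le_mul_iff_right (by simp [hN]) (by finiteness)).1 h4
  refine ne_top_of_le_ne_top (b := 2 * S) (by finiteness) ?_
  rw [ENNReal.tsum_eq_iSup_sum]
  refine iSup_le fun F => ?_
  have hF : ∑ k ∈ F, w k ≠ ∞ := ENNReal.sum_ne_top.2 fun k _ => hwfin k
  -- At this level `R` the truncation has no effect on the finite set `F`.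
  refine le_trans ?_ (key (1 + ∑ k ∈ F, w k) (by simp) (by finiteness))
  refine le_trans (Finset.sum_le_sum fun k hk => ?_) (ENNReal.sum_le_tsum F)
  rw [min_eq_left]
  exact (Finset.single_le_sum (f := w) (fun _ _ => zero_le) hk).trans le_add_self

/-! ### Fourier coefficients on the circle -/

/-- The `k`-th Fourier coefficient of a function on the circle. -/
def circleCoeff (u : Circle → ℂ) (k : ℤ) : ℂ :=
  (1 / (2 * Real.pi) : ℝ) • ∫ t in (0 : ℝ)..2 * Real.pi,
    (Circle.exp t : ℂ) ^ (-k) * u (Circle.exp t)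

theorem continuous_circle_zpow (k : ℤ) : Continuous fun z : Circle => (z : ℂ) ^ k :=
  Continuous.zpow₀ (by fun_prop) k fun z => Or.inl z.coe_ne_zero

theorem continuous_circleExp_zpow (k : ℤ) : Continuous fun t : ℝ => (Circle.exp t : ℂ) ^ k :=
  (continuous_circle_zpow k).comp Circle.exp.continuous

theorem hasDerivAt_circleExp_zpow (k : ℤ) (t : ℝ) :
    HasDerivAt (fun t : ℝ => (Circle.exp t : ℂ) ^ k)
      (Complex.I * k * (Circle.exp t : ℂ) ^ k) t := by
  have h : (fun t : ℝ => (Circle.exp t : ℂ) ^ k) = fun t : ℝ => Complex.exp (k * (t * Complex.I)) := by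
    ext t; rw [Circle.coe_exp, ← Complex.exp_int_mul]
  rw [h, Circle.coe_exp, ← Complex.exp_int_mul]
  have h1 : HasDerivAt (fun t : ℝ => (k : ℂ) * ((t : ℂ) * Complex.I)) (k * (1 * Complex.I)) t :=
    ((Complex.ofRealCLM.hasDerivAt (x := t)).mul_const _).const_mul _
  convert h1.cexp using 1
  ring

theorem norm_circleExp_zpow (k : ℤ) (t : ℝ) : ‖(Circle.exp t : ℂ) ^ k‖ = 1 := by simp

local instance : Fact (0 < 2 * Real.pi) := ⟨Real.two_pi_pos⟩

theorem circleCoeff_eq_fourierCoeff (u : Circle → ℂ) (k : ℤ) :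
    circleCoeff u k =
      fourierCoeff (fun x : AddCircle (2 * Real.pi) => u (AddCircle.toCircle x)) k := by
  rw [fourierCoeff_eq_intervalIntegral _ k 0, circleCoeff, zero_add]
  congr 1
  refine intervalIntegral.integral_congr fun t _ => ?_
  simp only [fourier_apply, AddCircle.toCircle_zsmul, AddCircle.toCircle_apply_mk, smul_eq_mul]
  rw [div_self Real.two_pi_pos.ne', one_mul, Circle.coe_zpow]

/-- Parseval's identity: a continuous function is square integrable. -/
theorem summable_sq_circleCoeff {u : Circle → ℂ} (hu : Continuous u) :
    Summable fun k => ‖circleCoeff u k‖ ^ 2 := by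
  let f : C(AddCircle (2 * Real.pi), ℂ) :=
    ⟨fun x => u (AddCircle.toCircle x), hu.comp AddCircle.continuous_toCircle⟩
  have := (hasSum_sq_fourierCoeff
    (ContinuousMap.toLp (E := ℂ) 2 AddCircle.haarAddCircle ℂ f)).summable
  simp_rw [fourierCoeff_toLp] at this
  simp_rw [circleCoeff_eq_fourierCoeff]
  exact this

theorem hasSum_circleCoeff {u : Circle → ℂ} (hu : Continuous u)
    (hs : Summable (circleCoeff u)) (z : Circle) :
    HasSum (fun k : ℤ => (z : ℂ) ^ k * circleCoeff u k) (u z) := by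
  let f : C(AddCircle (2 * Real.pi), ℂ) :=
    ⟨fun x => u (AddCircle.toCircle x), hu.comp AddCircle.continuous_toCircle⟩
  have hf : Summable (fourierCoeff f) := by
    convert hs using 1
    ext k
    rw [circleCoeff_eq_fourierCoeff]
    rfl
  obtain ⟨t, rfl⟩ := Circle.exp_surjective z
  convert has_pointwise_sum_fourier_series_of_summable hf (t : AddCircle (2 * Real.pi)) using 1
  · ext k
    rw [circleCoeff_eq_fourierCoeff, smul_eq_mul, mul_comm, fourier_apply, AddCircle.toCircle_zsmul,
      AddCircle.toCircle_apply_mk, div_self Real.two_pi_pos.ne', one_mul, Circle.coe_zpow]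
    rfl
  · simp [f, AddCircle.toCircle_apply_mk]

/-- The circle carries the quotient topology from the line, so continuity can be tested upstairs. -/
theorem continuous_of_circleExp {u : Circle → ℂ} (hu : Continuous fun t => u (Circle.exp t)) :
    Continuous u := by
  have h : Continuous (u ∘ AddCircle.homeomorphCircle') := continuous_coinduced_dom.2 hu
  exact AddCircle.homeomorphCircle'.comp_continuous_iff'.1 h

/-- Integration by parts: `D` multiplies the `k`-th coefficient by `k`. -/
theorem circleCoeff_deriv {u v : Circle → ℂ} (hv : Continuous v)
    (h : ∀ t : ℝ, HasDerivAt (fun t => u (Circle.exp t)) (v (Circle.exp t)) t) (k : ℤ) :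
    circleCoeff v k = Complex.I * k * circleCoeff u k := by
  have hu : Continuous fun t => u (Circle.exp t) :=
    continuous_iff_continuousAt.2 fun t => (h t).continuousAt
  have hd : ∀ t : ℝ, HasDerivAt (fun t : ℝ => (Circle.exp t : ℂ) ^ (-k) * u (Circle.exp t))
      ((Circle.exp t : ℂ) ^ (-k) * v (Circle.exp t) -
        Complex.I * k * ((Circle.exp t : ℂ) ^ (-k) * u (Circle.exp t))) t := by
    intro t
    refine ((hasDerivAt_circleExp_zpow (-k) t).mul (h t)).congr_deriv ?_
    push_cast
    ring
  have hvc : Continuous fun t : ℝ => (Circle.exp t : ℂ) ^ (-k) * v (Circle.exp t) :=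
    (continuous_circleExp_zpow _).mul (hv.comp Circle.exp.continuous)
  have huc : Continuous fun t : ℝ => (Circle.exp t : ℂ) ^ (-k) * u (Circle.exp t) :=
    (continuous_circleExp_zpow _).mul hu
  have hint := intervalIntegral.integral_eq_sub_of_hasDerivAt
    (a := 0) (b := 2 * Real.pi) (fun t _ => hd t)
    ((hvc.sub (huc.const_mul _)).intervalIntegrable _ _)
  rw [intervalIntegral.integral_sub (hvc.intervalIntegrable _ _)
    ((huc.const_mul _).intervalIntegrable _ _), intervalIntegral.integral_const_mul] at hint
  -- The boundary terms cancel because both endpoints map to the same point of the circle.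
  simp only [Circle.exp_two_pi, Circle.exp_zero, sub_self] at hint
  rw [circleCoeff, circleCoeff, sub_eq_zero.1 hint, mul_smul_comm]

/-- Fourier coefficients of a product are the convolution of the coefficients. -/
theorem hasSum_circleCoeff_mul {A u : Circle → ℂ} {a : ℤ → ℂ} (hu : Continuous u)
    (ha : Summable fun k => ‖a k‖) (hA : ∀ z : Circle, HasSum (fun k : ℤ => (z : ℂ) ^ k * a k) (A z))
    (k : ℤ) :
    HasSum (fun m => a m * circleCoeff u (k - m)) (circleCoeff (fun z => A z * u z) k) := by
  have huc : Continuous fun t => u (Circle.exp t) := hu.comp Circle.exp.continuous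
  obtain ⟨C, hC⟩ := (isCompact_range hu).isBounded.exists_norm_le
  have hC' : ∀ z, ‖u z‖ ≤ C := fun z => hC _ ⟨z, rfl⟩
  -- The series of `A` is integrated term by term, dominated by `‖a m‖ * C`; the factor `z ^ m`
  -- shifts the frequency from `k` to `k - m`.
  have hI := intervalIntegral.hasSum_integral_of_dominated_convergence
    (μ := MeasureTheory.volume) (a := 0) (b := 2 * Real.pi)
    (F := fun (m : ℤ) (t : ℝ) => a m * ((Circle.exp t : ℂ) ^ (-(k - m)) * u (Circle.exp t)))
    (f := fun t => (Circle.exp t : ℂ) ^ (-k) * (A (Circle.exp t) * u (Circle.exp t)))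
    (fun m _ => ‖a m‖ * C)
    (fun m => (((continuous_circleExp_zpow _).mul huc).const_mul _).aestronglyMeasurable)
    (fun m => .of_forall fun t _ => by
      rw [norm_mul, norm_mul, norm_circleExp_zpow, one_mul]
      exact mul_le_mul_of_nonneg_left (hC' _) (norm_nonneg _))
    (.of_forall fun t _ => ha.mul_right C) intervalIntegrable_const
    (.of_forall fun t _ => by
      have := (hA (Circle.exp t)).mul_right
        ((Circle.exp t : ℂ) ^ (-k) * u (Circle.exp t))
      rw [mul_left_comm]
      refine this.congr_fun fun m => ?_
      rw [show -(k - m) = m + -k by ring, zpow_add₀ (Circle.coe_ne_zero _)]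
      ring)
  refine (hI.const_smul (1 / (2 * Real.pi) : ℝ)).congr_fun fun m => ?_
  rw [intervalIntegral.integral_const_mul, ← mul_smul_comm]
  rfl

theorem continuous_of_hasSum_circle {A : Circle → ℂ} {a : ℤ → ℂ} (ha : Summable fun k => ‖a k‖)
    (hA : ∀ z : Circle, HasSum (fun k : ℤ => (z : ℂ) ^ k * a k) (A z)) : Continuous A := by
  have : A = fun z : Circle => ∑' k : ℤ, (z : ℂ) ^ k * a k := by
    ext z; exact (hA z).tsum_eq.symm
  rw [this]
  refine continuous_tsum (fun k => (continuous_circle_zpow k).mul continuous_const) ha fun k z => ?_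
  rw [norm_mul, norm_zpow, Circle.norm_coe, one_zpow, one_mul]

/-! ### Regularity of solutions of linear systems over `A_w` -/

/-- Submultiplicativity at `0` gives `1 ≤ w 0`, and symmetry gives `w 0 ≤ w k * w (-k) = (w k)²`. -/
theorem IsWeight.one_le {w : ℤ → ℝ} (hw : IsWeight w) (k : ℤ) : 1 ≤ w k := by
  have h0 : 1 ≤ w 0 := by
    have := hw.submul 0 0
    have h := hw.pos 0
    simp only [add_zero] at this
    exact le_of_mul_le_mul_left (by simpa using this) h
  have h1 := hw.submul k (-k)
  rw [hw.symm, add_neg_cancel] at h1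
  nlinarith [hw.pos k]

/-- Solutions on the circle of a linear system with coefficients in `A_w` lie in `A_w`. -/
theorem summable_circleCoeff_of_linear_system {ι : Type*} [Fintype ι] {w : ℤ → ℝ} (hw : IsWeight w)
    {A : ι → ι → Circle → ℂ} {a : ι → ι → ℤ → ℂ} (ha : ∀ p q, Summable fun k => ‖a p q k‖ * w k)
    (hA : ∀ p q (z : Circle), HasSum (fun k : ℤ => (z : ℂ) ^ k * a p q k) (A p q z))
    {u : ι → Circle → ℂ}
    (hu : ∀ p (t : ℝ), HasDerivAt (fun t => u p (Circle.exp t))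
      (∑ q, A p q (Circle.exp t) * u q (Circle.exp t)) t) (p : ι) :
    (Summable fun k => ‖circleCoeff (u p) k‖ * w k) ∧
      ∀ z : Circle, HasSum (fun k : ℤ => (z : ℂ) ^ k * circleCoeff (u p) k) (u p z) := by
  have ha1 : ∀ p q, Summable fun k => ‖a p q k‖ := fun p q =>
    Summable.of_nonneg_of_le (fun _ => norm_nonneg _)
      (fun k => le_mul_of_one_le_right (norm_nonneg _) (hw.one_le k)) (ha p q)
  have hAc : ∀ p q, Continuous (A p q) := fun p q => continuous_of_hasSum_circle (ha1 p q) (hA p q)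
  have huc : ∀ p, Continuous (u p) := fun p => continuous_of_circleExp
    (continuous_iff_continuousAt.2 fun t => (hu p t).continuousAt)
  have hvc : ∀ p, Continuous fun z => ∑ q, A p q z * u q z := fun p =>
    continuous_finsetSum _ fun q _ => (hAc p q).mul (huc q)
  have hd : ∀ p k, circleCoeff (fun z => ∑ q, A p q z * u q z) k =
      Complex.I * k * circleCoeff (u p) k := fun p k => circleCoeff_deriv (hvc p) (hu p) k
  -- The derivative is continuous, so `k û(k)` is square summable. Pairing it with the square
  -- summable `1/k` through `2ab ≤ a² + b²` gives absolute summability of `û`; the frequency `0` is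
  -- treated separately by `h3`.
  have hsum : ∀ p, Summable fun k => ‖circleCoeff (u p) k‖ := by
    intro p
    have h1 := summable_sq_circleCoeff (hvc p)
    have h2 : Summable fun k : ℤ => 1 / (k : ℝ) ^ 2 :=
      Real.summable_one_div_int_pow.2 one_lt_two
    have h3 : Summable fun k : ℤ => if k = 0 then ‖circleCoeff (u p) 0‖ else 0 :=
      (hasSum_ite_eq 0 _).summable
    refine Summable.of_nonneg_of_le (fun _ => norm_nonneg _) (fun k => ?_) ((h1.add h2).add h3)
    rcases eq_or_ne k 0 with rfl | hk
    · simp only [if_true]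
      exact le_add_of_nonneg_left (by positivity)
    · rw [if_neg hk, add_zero, hd]
      have hk' : (0 : ℝ) < |(k : ℝ)| := abs_pos.2 (by exact_mod_cast hk)
      rw [norm_mul, norm_mul, Complex.norm_I, one_mul, Complex.norm_intCast, ← sq_abs (k : ℝ)]
      set x := ‖circleCoeff (u p) k‖
      set y := |(k : ℝ)|
      have hx : 0 ≤ x := norm_nonneg _
      have : x = (y * x) * (1 / y) := by field_simp
      have h4 := two_mul_le_add_sq (y * x) (1 / y)
      rw [show (1 : ℝ) / y ^ 2 = (1 / y) ^ 2 by rw [div_pow, one_pow]]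
      nlinarith
  refine ⟨?_, hasSum_circleCoeff (huc p) (hsum p).of_norm⟩
  -- Summing over all components turns the coupled system into one scalar convolution inequality.
  have hconv : ∀ k : ℤ, (k.natAbs : ENNReal) * ∑ p, ‖circleCoeff (u p) k‖ₑ ≤
      ∑' m, (∑ p, ∑ q, ‖a p q m‖ₑ) * ∑ p, ‖circleCoeff (u p) (k - m)‖ₑ := by
    intro k
    calc (k.natAbs : ENNReal) * ∑ p, ‖circleCoeff (u p) k‖ₑ
        = ∑ p, ‖circleCoeff (fun z => ∑ q, A p q z * u q z) k‖ₑ := by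
          rw [Finset.mul_sum]
          refine Finset.sum_congr rfl fun p _ => ?_
          rw [hd, enorm_mul, enorm_mul]
          congr 1
          rw [← ofReal_norm, ← ofReal_norm, Complex.norm_I, Complex.norm_intCast,
            ENNReal.ofReal_one, one_mul, ← Int.cast_abs, Int.abs_eq_natAbs, Int.cast_natCast,
            ENNReal.ofReal_natCast]
      _ ≤ ∑ p, ∑ q, ‖circleCoeff (fun z => A p q z * u q z) k‖ₑ := by
          refine Finset.sum_le_sum fun p _ => ?_
          have : circleCoeff (fun z => ∑ q, A p q z * u q z) k =
              ∑ q, circleCoeff (fun z => A p q z * u q z) k := by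
            simp only [circleCoeff, Finset.mul_sum]
            rw [intervalIntegral.integral_finsetSum, Finset.smul_sum]
            intro q _
            exact ((continuous_circleExp_zpow _).mul
              (((hAc p q).mul (huc q)).comp Circle.exp.continuous)).intervalIntegrable _ _
          rw [this]
          exact enorm_sum_le _ _
      _ ≤ ∑ p, ∑ q, ∑' m, ‖a p q m‖ₑ * ‖circleCoeff (u q) (k - m)‖ₑ := by
          refine Finset.sum_le_sum fun p _ => Finset.sum_le_sum fun q _ => ?_
          rw [← (hasSum_circleCoeff_mul (huc q) (ha1 p q) (hA p q) k).tsum_eq]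
          simp_rw [← enorm_mul]
          exact enorm_tsum_le_tsum_enorm
      _ ≤ ∑ p, ∑ q, ∑' m, ‖a p q m‖ₑ * ∑ r, ‖circleCoeff (u r) (k - m)‖ₑ := by
          refine Finset.sum_le_sum fun p _ => Finset.sum_le_sum fun q _ =>
            ENNReal.tsum_le_tsum fun m => ?_
          gcongr
          exact Finset.single_le_sum (f := fun r => ‖circleCoeff (u r) (k - m)‖ₑ)
            (fun _ _ => zero_le) (Finset.mem_univ q)
      _ = _ := by
          simp_rw [Finset.sum_mul]
          rw [Summable.tsum_finsetSum fun _ _ => ENNReal.summable]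
          refine Finset.sum_congr rfl fun p _ => ?_
          rw [Summable.tsum_finsetSum fun _ _ => ENNReal.summable]
  have hfin : ∀ {f : ℤ → ℂ}, (Summable fun k => ‖f k‖ * w k) ↔
      ∑' k, ‖f k‖ₑ * ENNReal.ofReal (w k) ≠ ⊤ := by
    intro f
    have : ∀ k, ‖f k‖ₑ * ENNReal.ofReal (w k) = ENNReal.ofReal (‖f k‖ * w k) := fun k => by
      rw [ENNReal.ofReal_mul (norm_nonneg _), ofReal_norm]
    simp_rw [this]
    refine ⟨fun h => h.tsum_ofReal_ne_top, fun h => ?_⟩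
    have := ENNReal.summable_toReal h
    simpa only [ENNReal.toReal_ofReal (mul_nonneg (norm_nonneg _) (hw.pos _).le)] using this
  have main := tsum_mul_weight_ne_top (s := fun k => ∑ p, ‖circleCoeff (u p) k‖ₑ)
    (a := fun m => ∑ p, ∑ q, ‖a p q m‖ₑ) (w := fun k => ENNReal.ofReal (w k))
    (by
      rw [Summable.tsum_finsetSum fun _ _ => ENNReal.summable]
      refine ENNReal.sum_ne_top.2 fun p _ => ?_
      simpa only [← ofReal_norm] using (hsum p).tsum_ofReal_ne_top)
    (by
      simp_rw [Finset.sum_mul]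
      rw [Summable.tsum_finsetSum fun _ _ => ENNReal.summable]
      refine ENNReal.sum_ne_top.2 fun p _ => ?_
      rw [Summable.tsum_finsetSum fun _ _ => ENNReal.summable]
      exact ENNReal.sum_ne_top.2 fun q _ => hfin.1 (ha p q))
    (fun k => ENNReal.ofReal_ne_top)
    (fun k => ENNReal.one_le_ofReal.2 (hw.one_le k))
    (fun k m => by
      rw [← ENNReal.ofReal_mul (hw.pos k).le]
      exact ENNReal.ofReal_le_ofReal (hw.submul k m))
    hconv
  refine hfin.2 (ne_top_of_le_ne_top main (ENNReal.tsum_le_tsum fun k => ?_))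
  gcongr
  exact Finset.single_le_sum (f := fun r => ‖circleCoeff (u r) k‖ₑ)
    (fun _ _ => zero_le) (Finset.mem_univ p)

/-! ### The Cartan subalgebra and its real form -/

section CompactForm

variable {n : ℕ} {𝔤 : LieSubalgebra ℂ (Mat n)} {𝔥 : LieSubalgebra ℂ 𝔤} {l : ℕ}
  {α : Fin l → Module.Dual ℂ 𝔥} {E : Module.Dual ℂ 𝔥 → 𝔤}

theorem aAlg_le (X : Mat n) (hX : X ∈ aAlg 𝔥 E) : X ∈ 𝔤 := by
  induction hX using Submodule.span_induction with
  | mem X h =>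
    obtain ⟨β, -, rfl⟩ := h
    exact (Hvec E β).2
  | zero => exact zero_mem 𝔤
  | add X Y _ _ hX hY => exact add_mem hX hY
  | smul r X _ hX =>
    rw [← Complex.coe_smul]
    exact 𝔤.smul_mem _ hX

theorem Hvec_mem_aAlg {β : Module.Dual ℂ 𝔥} (hβ : IsRoot 𝔥 β) : (Hvec E β : Mat n) ∈ aAlg 𝔥 E :=
  Submodule.subset_span ⟨β, hβ, rfl⟩

/-- The Cartan subalgebra is spanned by the coroots of the simple roots. -/
theorem exists_eq_sum_Hvec (hcartan : 𝔥.IsCartanSubalgebra) (hα : IsSimpleRoots 𝔥 α)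
    (hE : IsChevalleyBasis 𝔥 α E) {h : 𝔤} (hh : h ∈ 𝔥) :
    ∃ d : Fin l → ℂ, h = ∑ i, d i • Hvec E (α i) := by
  classical
  let b := Module.Basis.mk hE.linearIndependent hE.span_eq_top.ge
  have hbE : ∀ β : {β // IsRoot 𝔥 β}, b (Sum.inl β) = E β.1 := fun β => by
    simp [b, Module.Basis.mk_apply]
  have hbH : ∀ i, b (Sum.inr i) = Hvec E (α i) := fun i => by
    simp [b, Module.Basis.mk_apply]
  -- On the span of the root vectors, `ad h'` is diagonal with eigenvalues `β h'`.
  let V : Submodule ℂ 𝔤 :=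
    Submodule.span ℂ (Set.range fun β : {β // IsRoot 𝔥 β} => b (Sum.inl β))
  have hV : ∀ (h' : 𝔥) (y : 𝔤), y ∈ V → ⁅(h' : 𝔤), y⁆ ∈ V ∧
      ∀ β, b.repr ⁅(h' : 𝔤), y⁆ (Sum.inl β) = β.1 h' * b.repr y (Sum.inl β) := by
    intro h' y hy
    induction hy using Submodule.span_induction with
    | mem y hy =>
      obtain ⟨γ, rfl⟩ := hy
      have hγ : ⁅(h' : 𝔤), b (Sum.inl γ)⁆ = γ.1 h' • b (Sum.inl γ) := by
        rw [hbE]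
        exact hE.root_space γ.1 γ.2 h'
      refine ⟨?_, fun β => ?_⟩
      · change ⁅(h' : 𝔤), b (Sum.inl γ)⁆ ∈ V
        rw [hγ]
        exact V.smul_mem _ (Submodule.subset_span ⟨γ, rfl⟩)
      · change b.repr ⁅(h' : 𝔤), b (Sum.inl γ)⁆ _ = _ * b.repr (b (Sum.inl γ)) _
        rw [hγ, map_smul, Module.Basis.repr_self, Finsupp.smul_apply, smul_eq_mul]
        rcases eq_or_ne γ β with rfl | hne
        · rfl
        · rw [Finsupp.single_eq_of_ne (by simpa using hne.symm), mul_zero, mul_zero]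
    | zero => simp
    | add x y _ _ hx hy =>
      rw [lie_add]
      exact ⟨V.add_mem hx.1 hy.1, fun β => by
        rw [map_add, map_add, Finsupp.add_apply, Finsupp.add_apply, hx.2, hy.2, mul_add]⟩
    | smul c x _ hx =>
      rw [lie_smul]
      exact ⟨V.smul_mem c hx.1, fun β => by
        rw [map_smul, map_smul, Finsupp.smul_apply, Finsupp.smul_apply, hx.2, smul_eq_mul,
          smul_eq_mul, mul_left_comm]⟩
  let d : Fin l → ℂ := fun i => b.repr h (Sum.inr i)
  refine ⟨d, ?_⟩
  have hdecomp : ∀ y : 𝔤, y - ∑ i, b.repr y (Sum.inr i) • b (Sum.inr i) ∈ V := by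
    intro y
    have hy : y ∈ Submodule.span ℂ (Set.range b) := by rw [b.span_eq]; trivial
    induction hy using Submodule.span_induction with
    | mem y hy =>
      obtain ⟨β | j, rfl⟩ := hy
      · simp only [Module.Basis.repr_self]
        simpa using (Submodule.subset_span (Set.mem_range_self β) : b (Sum.inl β) ∈ V)
      · simp [Module.Basis.repr_self, Finsupp.single_apply]
    | zero => simp
    | add x y _ _ hx hy =>
      convert V.add_mem hx hy using 1
      simp only [map_add, Finsupp.add_apply, add_smul, Finset.sum_add_distrib]
      abel
    | smul c x _ hx =>
      convert V.smul_mem c hx using 1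
      simp only [map_smul, Finsupp.smul_apply, smul_sub, Finset.smul_sum, smul_smul, smul_eq_mul]
  -- The remainder lies both in `V`, where `ad h'` is diagonal, and in `𝔥`, where it is nilpotent.
  -- Each root is nonzero at some `h'`, which kills the corresponding coefficient.
  set y := h - ∑ i, d i • Hvec E (α i) with hy
  have hyV : y ∈ V := by
    have := hdecomp h
    simp_rw [hbH] at this
    exact this
  have hyH : y ∈ 𝔥 := by
    refine sub_mem hh (sum_mem fun i _ => 𝔥.smul_mem _ ?_)
    exact (hE.normalized _ (hα.isRoot i)).1
  have : LieRing.IsNilpotent 𝔥 := hcartan.nilpotent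
  obtain ⟨k, hk⟩ := LieModule.exists_forall_pow_toEnd_eq_zero ℂ 𝔥 𝔥
  have hiter : ∀ (h' : 𝔥) (m : ℕ),
      (((LieModule.toEnd ℂ 𝔥 𝔥 h') ^ m) ⟨y, hyH⟩ : 𝔤) ∈ V ∧ ∀ β,
      b.repr (((LieModule.toEnd ℂ 𝔥 𝔥 h') ^ m) ⟨y, hyH⟩ : 𝔤) (Sum.inl β) =
        β.1 h' ^ m * b.repr y (Sum.inl β) := by
    intro h' m
    induction m with
    | zero => simpa using hyV
    | succ m ih =>
      rw [pow_succ', Module.End.mul_apply, LieModule.toEnd_apply_apply, LieSubalgebra.coe_bracket]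
      refine ⟨(hV h' _ ih.1).1, fun β => ?_⟩
      rw [(hV h' _ ih.1).2, ih.2, pow_succ', mul_assoc]
  have hrepr : b.repr y = 0 := by
    ext (β | j)
    · obtain ⟨h', hh'⟩ : ∃ h', β.1 h' ≠ 0 := by
        by_contra! hcon
        exact β.2.1 (LinearMap.ext hcon)
      have := (hiter h' k).2 β
      rw [hk] at this
      simp only [LinearMap.zero_apply, ZeroMemClass.coe_zero, map_zero, Finsupp.coe_zero,
        Pi.zero_apply] at this
      simpa [hh'] using this.symm
    · rw [hy]
      simp only [← hbH, map_sub, map_sum, map_smul, Module.Basis.repr_self]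
      simp [d, Finsupp.single_apply]
  have hy0 : y = 0 := by simpa using hrepr
  exact sub_eq_zero.1 hy0

/-- `𝔥 = 𝔞 + i𝔞`. -/
theorem exists_real_imag_part (hcartan : 𝔥.IsCartanSubalgebra) (hα : IsSimpleRoots 𝔥 α)
    (hE : IsChevalleyBasis 𝔥 α E) {h : 𝔤} (hh : h ∈ 𝔥) :
    ∃ Y ∈ aAlg 𝔥 E, ∃ Z ∈ aAlg 𝔥 E, (h : Mat n) = Y + Complex.I • Z := by
  obtain ⟨d, rfl⟩ := exists_eq_sum_Hvec hcartan hα hE hh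
  refine ⟨∑ i, (d i).re • (Hvec E (α i) : Mat n),
    sum_mem fun i _ => Submodule.smul_mem _ _ (Hvec_mem_aAlg (hα.isRoot i)),
    ∑ i, (d i).im • (Hvec E (α i) : Mat n),
    sum_mem fun i _ => Submodule.smul_mem _ _ (Hvec_mem_aAlg (hα.isRoot i)), ?_⟩
  rw [Finset.smul_sum, ← Finset.sum_add_distrib]
  push_cast
  refine Finset.sum_congr rfl fun i _ => ?_
  conv_lhs => rw [← Complex.re_add_im (d i), add_smul, mul_comm, mul_smul]
  rw [Complex.coe_smul, Complex.coe_smul]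

/-! ### Stability of `𝔤` and `G` under conjugate transpose -/

/-- Both `E_β - E_{-β}` and `i (E_β + E_{-β})` are skew-Hermitian; adding the two relations isolates
`E_βᴴ`. -/
theorem conjTranspose_E (hreal : IsIwasawaCompatible 𝔥 α E) {β : Module.Dual ℂ 𝔥}
    (hβ : IsRoot 𝔥 β) : (E β : Mat n)ᴴ = (E (-β) : Mat n) := by
  have h1 := hreal.k_skew _ (Submodule.subset_span ⟨β, hβ, Or.inr (Or.inl rfl)⟩)
  have h2 := hreal.k_skew _ (Submodule.subset_span ⟨β, hβ, Or.inr (Or.inr rfl)⟩)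
  rw [Matrix.conjTranspose_sub] at h1
  rw [Matrix.conjTranspose_smul, Matrix.conjTranspose_add, Complex.star_def, Complex.conj_I,
    neg_smul, neg_inj] at h2
  have h3 : (E β : Mat n)ᴴ + (E (-β) : Mat n)ᴴ = (E β : Mat n) + (E (-β) : Mat n) :=
    smul_right_injective (Mat n) Complex.I_ne_zero h2
  have h4 : (2 : ℂ) • (E β : Mat n)ᴴ = (2 : ℂ) • (E (-β) : Mat n) := by
    rw [two_smul, two_smul]
    calc _ = ((E β : Mat n)ᴴ - (E (-β) : Mat n)ᴴ) + ((E β : Mat n)ᴴ + (E (-β) : Mat n)ᴴ) := by abel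
      _ = -((E β : Mat n) - (E (-β) : Mat n)) + ((E β : Mat n) + (E (-β) : Mat n)) := by rw [h1, h3]
      _ = _ := by abel
  exact smul_right_injective (Mat n) two_ne_zero h4

theorem conjTranspose_mem (hα : IsSimpleRoots 𝔥 α) (hE : IsChevalleyBasis 𝔥 α E)
    (hreal : IsIwasawaCompatible 𝔥 α E) {X : Mat n} (hX : X ∈ 𝔤) : Xᴴ ∈ 𝔤 := by
  have key : ∀ x : 𝔤, (x : Mat n)ᴴ ∈ 𝔤 := by
    intro x
    have hx : x ∈ Submodule.span ℂ (Set.range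
        (Sum.elim (fun β : {β // IsRoot 𝔥 β} => E β.1) (fun i => Hvec E (α i)))) := by
      rw [hE.span_eq_top]
      trivial
    induction hx using Submodule.span_induction with
    | mem x hx =>
      obtain ⟨β | i, rfl⟩ := hx
      · simp only [Sum.elim_inl]
        rw [conjTranspose_E hreal β.2]
        exact (E _).2
      · simp only [Sum.elim_inr]
        obtain ⟨d, hd⟩ := hreal.a_diag _ (Hvec_mem_aAlg (E := E) (hα.isRoot i))
        have : (Hvec E (α i) : Mat n)ᴴ = (Hvec E (α i) : Mat n) := by
          rw [hd, Matrix.diagonal_conjTranspose]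
          congr 1
          ext i
          simp
        rw [this]
        exact (Hvec E _).2
    | zero => simp
    | add x y _ _ hx hy =>
      push_cast
      rw [Matrix.conjTranspose_add]
      exact add_mem hx hy
    | smul c x _ hx =>
      push_cast
      rw [Matrix.conjTranspose_smul]
      exact 𝔤.smul_mem _ hx
  exact key ⟨X, hX⟩

/-- Conjugate transpose reverses products and commutes with `exp`, so it permutes the generators of
`G`. This is what places `gᴴ g` in `G`. -/
theorem exists_coe_eq_conjTranspose (hα : IsSimpleRoots 𝔥 α) (hE : IsChevalleyBasis 𝔥 α E)
    (hreal : IsIwasawaCompatible 𝔥 α E) {g : SLn n} (hg : g ∈ G 𝔤) :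
    ∃ g' ∈ G 𝔤, (g' : Mat n) = (g : Mat n)ᴴ := by
  induction hg using Subgroup.closure_induction with
  | mem g h =>
    obtain ⟨X, hX, hgX⟩ := h
    have hdet : (g : Mat n)ᴴ.det = 1 := by rw [Matrix.det_conjTranspose, g.2, star_one]
    refine ⟨⟨(g : Mat n)ᴴ, hdet⟩, Subgroup.subset_closure ⟨Xᴴ, conjTranspose_mem hα hE hreal hX, ?_⟩,
      rfl⟩
    rw [Matrix.exp_conjTranspose, ← hgX]
  | one => exact ⟨1, one_mem _, by simp⟩
  | mul x y _ _ hx hy =>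
    obtain ⟨x', hx', hxe⟩ := hx
    obtain ⟨y', hy', hye⟩ := hy
    exact ⟨y' * x', mul_mem hy' hx', by
      rw [Matrix.SpecialLinearGroup.coe_mul, Matrix.SpecialLinearGroup.coe_mul,
        Matrix.conjTranspose_mul, hxe, hye]⟩
  | inv x _ hx =>
    obtain ⟨x', hx', hxe⟩ := hx
    refine ⟨x'⁻¹, inv_mem hx', ?_⟩
    have h1 : (x' : Mat n) * ((x⁻¹ : SLn n) : Mat n)ᴴ = 1 := by
      rw [hxe, ← Matrix.conjTranspose_mul, ← Matrix.SpecialLinearGroup.coe_mul, inv_mul_cancel]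
      simp
    have h2 : ((x'⁻¹ : SLn n) : Mat n) * (x' : Mat n) = 1 := by
      rw [← Matrix.SpecialLinearGroup.coe_mul, inv_mul_cancel]
      simp
    exact left_inv_eq_right_inv h2 h1

/-! ### Diagonal exponentials and the Cartan subgroup -/

theorem exp_diagonal_apply (d : Fin n → ℂ) :
    NormedSpace.exp (Matrix.diagonal d : Mat n) = Matrix.diagonal fun i => Complex.exp (d i) := by
  rw [Matrix.exp_diagonal]
  congr 1
  ext i
  rw [Pi.coe_exp, Complex.exp_eq_exp_ℂ]

/-- Exponentials of diagonal elements of `𝔤`, computed entrywise, lie in `G`. -/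
theorem exists_coe_eq_diagonal_exp (hsl : 𝔤 ≤ LieAlgebra.SpecialLinear.sl (Fin n) ℂ)
    {d : Fin n → ℂ} (hd : (Matrix.diagonal d : Mat n) ∈ 𝔤) :
    ∃ g ∈ G 𝔤, (g : Mat n) = Matrix.diagonal fun i => Complex.exp (d i) := by
  have htr : ∑ i, d i = 0 := by
    have : Matrix.trace (Matrix.diagonal d : Mat n) = 0 :=
      hsl hd
    rwa [Matrix.trace_diagonal] at this
  have hdet : (Matrix.diagonal fun i => Complex.exp (d i) : Mat n).det = 1 := by
    rw [Matrix.det_diagonal, ← Complex.exp_sum, htr, Complex.exp_zero]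
  refine ⟨⟨_, hdet⟩, Subgroup.subset_closure ⟨_, hd, ?_⟩, rfl⟩
  exact (exp_diagonal_apply d).symm

/-- Since `𝔥 = 𝔞 + i𝔞` is diagonal, exponents simply add under products. Modulus `y` and phase `z`
are kept apart because unitarity will remove the first and positivity the second. -/
theorem exists_diagonal_of_mem_cartanSubgroup (hcartan : 𝔥.IsCartanSubalgebra)
    (hα : IsSimpleRoots 𝔥 α) (hE : IsChevalleyBasis 𝔥 α E)
    (hreal : IsIwasawaCompatible 𝔥 α E) {g : SLn n} (hg : g ∈ cartanSubgroup 𝔥) :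
    ∃ y z : Fin n → ℝ, (Matrix.diagonal fun i => (y i : ℂ)) ∈ aAlg 𝔥 E ∧
      (Matrix.diagonal fun i => (z i : ℂ)) ∈ aAlg 𝔥 E ∧
      (g : Mat n) = Matrix.diagonal fun i => Complex.exp (y i + Complex.I * z i) := by
  induction hg using Subgroup.closure_induction with
  | mem g h =>
    obtain ⟨_, ⟨h, hh, rfl⟩, hgX⟩ := h
    obtain ⟨Y, hY, Z, hZ, hYZ⟩ := exists_real_imag_part hcartan hα hE hh
    obtain ⟨y, rfl⟩ := hreal.a_diag Y hY
    obtain ⟨z, rfl⟩ := hreal.a_diag Z hZ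
    refine ⟨y, z, hY, hZ, ?_⟩
    simp only at hgX
    rw [hgX, hYZ, ← Matrix.diagonal_smul, Matrix.diagonal_add, exp_diagonal_apply]
    rfl
  | one =>
    refine ⟨0, 0, ?_, ?_, ?_⟩ <;> simp
  | mul g g' _ _ h h' =>
    obtain ⟨y, z, hy, hz, hg⟩ := h
    obtain ⟨y', z', hy', hz', hg'⟩ := h'
    refine ⟨y + y', z + z', ?_, ?_, ?_⟩
    · simpa [Matrix.diagonal_add] using add_mem hy hy'
    · simpa [Matrix.diagonal_add] using add_mem hz hz'
    · rw [Matrix.SpecialLinearGroup.coe_mul, hg, hg', Matrix.diagonal_mul_diagonal]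
      congr 1
      ext i
      rw [← Complex.exp_add]
      simp only [Pi.add_apply, Complex.ofReal_add]
      ring_nf
  | inv g _ h =>
    obtain ⟨y, z, hy, hz, hg⟩ := h
    refine ⟨-y, -z, ?_, ?_, ?_⟩
    · simpa [Matrix.diagonal_neg] using neg_mem hy
    · simpa [Matrix.diagonal_neg] using neg_mem hz
    · have h1 : ((g⁻¹ : SLn n) : Mat n) * (g : Mat n) = 1 := by
        rw [← Matrix.SpecialLinearGroup.coe_mul, inv_mul_cancel]
        simp
      refine left_inv_eq_right_inv h1 ?_
      rw [hg, Matrix.diagonal_mul_diagonal, ← Matrix.diagonal_one]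
      congr 1
      ext i
      rw [← Complex.exp_add, Complex.exp_eq_one_iff]
      refine ⟨0, ?_⟩
      simp only [Pi.neg_apply, Complex.ofReal_neg]
      push_cast
      ring

/-! ### Diagonalizing regular unitary elements under `K` -/

open scoped ComplexOrder in
/-- A regular unitary element of `G` is conjugate under `K` to an element of `exp(i𝔞)`. -/
theorem exists_unitary_conj_of_isRegular (hsl : 𝔤 ≤ LieAlgebra.SpecialLinear.sl (Fin n) ℂ)
    (hcartan : 𝔥.IsCartanSubalgebra) (hα : IsSimpleRoots 𝔥 α) (hE : IsChevalleyBasis 𝔥 α E)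
    (hreal : IsIwasawaCompatible 𝔥 α E) {M : SLn n} (hMG : M ∈ G 𝔤)
    (hM : (M : Mat n)ᴴ * (M : Mat n) = 1) (hreg : IsRegular 𝔥 M) :
    ∃ k ∈ G 𝔤, (k : Mat n)ᴴ * (k : Mat n) = 1 ∧ ∃ z : Fin n → ℝ,
      (Matrix.diagonal fun i => (z i : ℂ)) ∈ aAlg 𝔥 E ∧
      (M : Mat n) * k = k * Matrix.diagonal fun i => Complex.exp (Complex.I * z i) := by
  obtain ⟨g, hg, hcent⟩ := hreg
  have hMmem : M ∈ G 𝔤 ⊓ Subgroup.centralizer {M} :=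
    ⟨hMG, Subgroup.mem_centralizer_singleton_iff.2 rfl⟩
  rw [hcent] at hMmem
  obtain ⟨h, hh, hgh⟩ := hMmem
  have hgh' : M * g = g * h := by
    rw [← hgh]
    simp [MulAut.conj_apply]
  obtain ⟨y, z, -, hz, hyz⟩ := exists_diagonal_of_mem_cartanSubgroup hcartan hα hE hreal hh
  obtain ⟨g', hg', hgg'⟩ := exists_coe_eq_conjTranspose hα hE hreal hg
  -- With `M = g h g⁻¹`, the aim is to correct `g` to a unitary element by the polar factor `P ^
  -- (-1/2)`, which has to be shown to lie in the torus.
  set P : SLn n := g' * g with hP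
  have hPc : (P : Mat n) = (g : Mat n)ᴴ * (g : Mat n) := by
    rw [hP, Matrix.SpecialLinearGroup.coe_mul, hgg']
  have hghm : (M : Mat n) * (g : Mat n) = (g : Mat n) * (h : Mat n) := by
    rw [← Matrix.SpecialLinearGroup.coe_mul, hgh', Matrix.SpecialLinearGroup.coe_mul]
  have hPh : (h : Mat n)ᴴ * (P : Mat n) * (h : Mat n) = P := by
    calc (h : Mat n)ᴴ * (P : Mat n) * (h : Mat n)
        = ((g : Mat n) * (h : Mat n))ᴴ * ((g : Mat n) * (h : Mat n)) := by
          rw [hPc, Matrix.conjTranspose_mul]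
          simp only [Matrix.mul_assoc]
      _ = (g : Mat n)ᴴ * ((M : Mat n)ᴴ * (M : Mat n)) * (g : Mat n) := by
          rw [← hghm, Matrix.conjTranspose_mul]
          simp only [Matrix.mul_assoc]
      _ = P := by rw [hM, Matrix.mul_one, hPc]
  have hPpos : ∀ i, 0 < (P : Mat n) i i := by
    intro i
    have hinj : Function.Injective ((g : Mat n).mulVec) :=
      Matrix.mulVec_injective_of_isUnit ((Matrix.isUnit_iff_isUnit_det _).2 (by rw [g.2]; exact isUnit_one))
    rw [hPc]
    exact (Matrix.PosDef.conjTranspose_mul_self _ hinj).diag_pos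
  -- The diagonal entries of `hᴴ P h = P` give `exp (2 y i) * P i i = P i i`, and `P i i > 0`.
  have hy0 : ∀ i, y i = 0 := by
    intro i
    have h1 := congrFun (congrFun hPh i) i
    rw [hyz, Matrix.diagonal_conjTranspose, Matrix.mul_diagonal, Matrix.diagonal_mul] at h1
    have h2 := congrArg norm h1
    have hn : ‖Complex.exp (y i + Complex.I * z i)‖ = Real.exp (y i) := by
      rw [Complex.norm_exp]
      simp
    rw [norm_mul, norm_mul, Pi.star_apply, norm_star, hn] at h2
    have hPn : 0 < ‖(P : Mat n) i i‖ := norm_pos_iff.2 (hPpos i).ne'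
    have h3 : Real.exp (y i) * Real.exp (y i) = 1 := by
      have : (Real.exp (y i) * Real.exp (y i)) * ‖(P : Mat n) i i‖ = 1 * ‖(P : Mat n) i i‖ := by
        rw [one_mul, mul_right_comm, h2]
      exact mul_right_cancel₀ hPn.ne' this
    rw [← Real.exp_add, Real.exp_eq_one_iff] at h3
    linarith
  have hhz : (h : Mat n) = Matrix.diagonal fun i => Complex.exp (Complex.I * z i) := by
    rw [hyz]
    simp [hy0]
  have hhu : (h : Mat n) * (h : Mat n)ᴴ = 1 := by
    rw [hhz, Matrix.diagonal_conjTranspose, Matrix.diagonal_mul_diagonal, ← Matrix.diagonal_one]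
    congr 1
    ext i
    rw [Pi.star_apply, Complex.star_def, ← Complex.exp_conj, ← Complex.exp_add]
    simp
  have hcomm : P * h = h * P := by
    have : (P : Mat n) * (h : Mat n) = (h : Mat n) * (P : Mat n) := by
      conv_rhs => rw [← hPh]
      rw [← Matrix.mul_assoc, ← Matrix.mul_assoc, hhu, Matrix.one_mul]
    exact Subtype.ext this
  have hMg : M = g * h * g⁻¹ := by rw [← hgh', mul_inv_cancel_right]
  -- Regularity enters here: `P` commutes with `h`, so `g P g⁻¹` centralizes `M` and hence lies in
  -- `g H g⁻¹`, forcing `P ∈ H`.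
  have hPmem : g * P * g⁻¹ ∈ G 𝔤 ⊓ Subgroup.centralizer {M} := by
    refine ⟨mul_mem (mul_mem hg (mul_mem hg' hg)) ((G 𝔤).inv_mem hg),
      Subgroup.mem_centralizer_singleton_iff.2 ?_⟩
    calc g * P * g⁻¹ * M = g * (P * h) * g⁻¹ := by rw [hMg]; group
      _ = M * (g * P * g⁻¹) := by rw [hcomm, hMg]; group
  rw [hcent] at hPmem
  obtain ⟨P', hP', hPP'⟩ := hPmem
  have hPeq : P' = P := by
    simpa [MulAut.conj_apply] using hPP'
  rw [hPeq] at hP'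
  obtain ⟨y', z', hy', -, hyz'⟩ := exists_diagonal_of_mem_cartanSubgroup hcartan hα hE hreal hP'
  -- Positive entries equal their moduli, so the phases `exp (i z')` are trivial even though `z'`
  -- itself need not vanish.
  have hPd : (P : Mat n) = Matrix.diagonal fun i => Complex.exp (y' i) := by
    have : ∀ i, Complex.exp (y' i + Complex.I * z' i) = Complex.exp (y' i) := by
      intro i
      have h1 := hPpos i
      rw [hyz', Matrix.diagonal_apply_eq] at h1
      have h2 := Complex.norm_of_nonneg' h1.le
      rw [← h2, Complex.norm_exp]
      simp
    rw [hyz']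
    simp only [this]
  have hhalf : (Matrix.diagonal fun i => ((-(y' i) / 2 : ℝ) : ℂ)) ∈ aAlg 𝔥 E := by
    convert (aAlg 𝔥 E).smul_mem (-1 / 2 : ℝ) hy' using 1
    rw [← Matrix.diagonal_smul]
    congr 1
    ext i
    simp
    ring
  -- Here `a = P ^ (-1/2)`: then `(g a)ᴴ (g a) = a P a = 1`, and `a` commutes with the diagonal `h`.
  obtain ⟨a, haG, ha⟩ := exists_coe_eq_diagonal_exp hsl (aAlg_le _ hhalf)
  refine ⟨g * a, mul_mem hg haG, ?_, z, hz, ?_⟩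
  · rw [Matrix.SpecialLinearGroup.coe_mul, Matrix.conjTranspose_mul]
    calc (a : Mat n)ᴴ * (g : Mat n)ᴴ * ((g : Mat n) * (a : Mat n))
        = (a : Mat n)ᴴ * (P : Mat n) * (a : Mat n) := by
          rw [hPc]
          simp only [Matrix.mul_assoc]
      _ = 1 := by
          rw [hPd, ha, Matrix.diagonal_conjTranspose, Matrix.diagonal_mul_diagonal,
            Matrix.diagonal_mul_diagonal, ← Matrix.diagonal_one]
          congr 1
          ext i
          rw [Pi.star_apply, Complex.star_def, ← Complex.exp_conj, ← Complex.exp_add,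
            ← Complex.exp_add, Complex.conj_ofReal, Complex.exp_eq_one_iff]
          refine ⟨0, ?_⟩
          push_cast
          ring
  · rw [Matrix.SpecialLinearGroup.coe_mul, ← hhz, ← Matrix.mul_assoc, hghm, Matrix.mul_assoc,
      Matrix.mul_assoc, hhz, ha, Matrix.diagonal_mul_diagonal, Matrix.diagonal_mul_diagonal]
    simp only [mul_comm]

end CompactForm

/-! ### Matrix differential equations and loops over `A_w` -/

section MatrixODE

variable {n : ℕ}

/-- Entrywise derivative of a matrix valued function of a real variable. -/
def HasMatDeriv (A : ℝ → Mat n) (A' : Mat n) (t : ℝ) : Prop :=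
  ∀ i j, HasDerivAt (fun s => A s i j) (A' i j) t

theorem HasMatDeriv.mul {A B : ℝ → Mat n} {A' B' : Mat n} {t : ℝ} (hA : HasMatDeriv A A' t)
    (hB : HasMatDeriv B B' t) : HasMatDeriv (fun s => A s * B s) (A' * B t + A t * B') t := by
  intro i j
  simp only [Matrix.mul_apply, Matrix.add_apply, ← Finset.sum_add_distrib]
  exact HasDerivAt.fun_sum fun k _ => (hA i k).fun_mul (hB k j)

theorem HasMatDeriv.mul_const {A : ℝ → Mat n} {A' : Mat n} {t : ℝ} (hA : HasMatDeriv A A' t)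
    (B : Mat n) : HasMatDeriv (fun s => A s * B) (A' * B) t := by
  intro i j
  simp only [Matrix.mul_apply]
  exact HasDerivAt.fun_sum fun k _ => (hA i k).mul_const (B k j)

theorem HasMatDeriv.conjTranspose {A : ℝ → Mat n} {A' : Mat n} {t : ℝ} (hA : HasMatDeriv A A' t) :
    HasMatDeriv (fun s => (A s)ᴴ) A'ᴴ t :=
  fun i j => (hA j i).star

theorem HasMatDeriv.eq_of_zero {A : ℝ → Mat n} (hA : ∀ t, HasMatDeriv A 0 t) (s t : ℝ) :
    A s = A t := by
  ext i j
  exact is_const_of_deriv_eq_zero (fun t => (hA t i j).differentiableAt)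
    (fun t => (hA t i j).deriv) s t

/-- For a skew-Hermitian system, `f* g` is constant when `f` and `g` are both solutions. -/
theorem conjTranspose_mul_eq_of_skew {x f g : ℝ → Mat n} (hx : ∀ t, (x t)ᴴ = -x t)
    (hf : ∀ t, HasMatDeriv f (x t * f t) t) (hg : ∀ t, HasMatDeriv g (x t * g t) t) (s t : ℝ) :
    (f s)ᴴ * g s = (f t)ᴴ * g t := by
  refine HasMatDeriv.eq_of_zero (A := fun s => (f s)ᴴ * g s) (fun t => ?_) s t
  convert (hf t).conjTranspose.mul (hg t) using 1
  rw [Matrix.conjTranspose_mul, hx]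
  simp [Matrix.mul_assoc]

theorem hasMatDeriv_diagonal_exp (m : Fin n → ℝ) (t : ℝ) :
    HasMatDeriv (fun s : ℝ => Matrix.diagonal fun i => Complex.exp (Complex.I * (s * m i)))
      ((Matrix.diagonal fun i => Complex.exp (Complex.I * (t * m i))) *
        Matrix.diagonal fun i => Complex.I * m i) t := by
  intro i j
  rw [Matrix.diagonal_mul_diagonal]
  rcases eq_or_ne i j with rfl | hij
  · simp only [Matrix.diagonal_apply_eq]
    have : HasDerivAt (fun s : ℝ => Complex.I * ((s : ℂ) * m i)) (Complex.I * (1 * m i)) t :=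
      ((Complex.ofRealCLM.hasDerivAt (x := t)).mul_const _).const_mul _
    simpa using this.cexp
  · simp only [Matrix.diagonal_apply_ne _ hij]
    exact hasDerivAt_const _ _

theorem coe_inv_of_unitary {g : SLn n} (hg : (g : Mat n)ᴴ * (g : Mat n) = 1) :
    ((g⁻¹ : SLn n) : Mat n) = (g : Mat n)ᴴ := by
  have h : (g : Mat n) * ((g⁻¹ : SLn n) : Mat n) = 1 := by
    rw [← Matrix.SpecialLinearGroup.coe_mul, mul_inv_cancel]
    simp
  exact (left_inv_eq_right_inv hg h).symm

theorem HasWSeries.hasSum_apply {w : ℤ → ℝ} {a : ℤ → Mat n} {f : Circle → Mat n}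
    (h : HasWSeries w a f) (i j : Fin n) (z : Circle) :
    HasSum (fun k : ℤ => (z : ℂ) ^ k * a k i j) (f z i j) :=
  Pi.hasSum.1 (Pi.hasSum.1 (h.2 z) i) j

/-- A loop `γ` with `γ' = x γ + γ d`, where `x` is a loop with entries in `A_w` and `d` is
a constant diagonal matrix, has entries in `A_w`. -/
theorem mem_MnA_of_hasMatDeriv {w : ℤ → ℝ} (hw : IsWeight w) {x γ : Circle → Mat n}
    (hx : x ∈ MnA w) (d : Fin n → ℂ)
    (hγ : ∀ t : ℝ, HasMatDeriv (fun t => γ (Circle.exp t))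
      (x (Circle.exp t) * γ (Circle.exp t) + γ (Circle.exp t) * Matrix.diagonal d) t) :
    γ ∈ MnA w := by
  classical
  obtain ⟨a, ha⟩ := hx
  have key : ∀ j i, (Summable fun k => ‖circleCoeff (fun z => γ z i j) k‖ * w k) ∧
      ∀ z : Circle, HasSum (fun k : ℤ => (z : ℂ) ^ k * circleCoeff (fun z => γ z i j) k)
        (γ z i j) := by
    intro j
    -- Right multiplication by `diagonal d` scales column `j` by `d j`, so each column solves its
    -- own system with matrix `x + d j`; the constant enters only the coefficient of index `0`.
    refine summable_circleCoeff_of_linear_system hw (u := fun i z => γ z i j)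
      (A := fun p q z => x z p q + if p = q then d j else 0)
      (a := fun p q k => a k p q + if k = 0 then (if p = q then d j else 0) else 0) ?_ ?_ ?_
    · intro p q
      have h0 : Summable fun k : ℤ =>
          if k = 0 then ‖(if p = q then d j else 0)‖ * w 0 else 0 := (hasSum_ite_eq 0 _).summable
      refine Summable.of_nonneg_of_le (fun k => mul_nonneg (norm_nonneg _) (hw.pos k).le)
        (fun k => ?_) ((ha.1 p q).add h0)
      refine (mul_le_mul_of_nonneg_right (norm_add_le _ _) (hw.pos k).le).trans ?_
      rw [add_mul]
      gcongr
      by_cases hk : k = 0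
      · simp [hk]
      · simp [hk]
    · intro p q z
      have h0 := hasSum_ite_eq (0 : ℤ) (if p = q then d j else 0)
      refine ((ha.hasSum_apply p q z).add h0).congr_fun fun k => ?_
      rw [mul_add]
      by_cases hk : k = 0
      · simp [hk]
      · simp [hk]
    · intro p t
      refine (hγ t p j).congr_deriv ?_
      rw [Matrix.add_apply, Matrix.mul_diagonal, Matrix.mul_apply]
      simp only [add_mul, Finset.sum_add_distrib]
      simp [mul_comm]
  refine ⟨fun k => Matrix.of fun i j => circleCoeff (fun z => γ z i j) k, fun i j => (key j i).1,
    fun z => ?_⟩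
  refine Pi.hasSum.2 fun i => Pi.hasSum.2 fun j => ?_
  exact (key j i).2 z

end MatrixODE

end TodaLoop

end

/-! ### The Floquet loop and the gauge identity -/

theorem mainTheorem7 {n : ℕ} (w : ℤ → ℝ) (hw : TodaLoop.IsWeight w)
    (𝔤 : LieSubalgebra ℂ (Matrix (Fin n) (Fin n) ℂ))
    (hsl : 𝔤 ≤ LieAlgebra.SpecialLinear.sl (Fin n) ℂ)
    (hsimple : LieAlgebra.IsSimple ℂ 𝔤)
    (hsc : SimplyConnectedSpace (TodaLoop.G 𝔤))
    (𝔥 : LieSubalgebra ℂ 𝔤) (hcartan : 𝔥.IsCartanSubalgebra)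
    {l : ℕ} (α : Fin l → Module.Dual ℂ 𝔥) (hα : TodaLoop.IsSimpleRoots 𝔥 α)
    (θ : Module.Dual ℂ 𝔥) (hθ : TodaLoop.IsHighestRoot 𝔥 α θ)
    (E : Module.Dual ℂ 𝔥 → 𝔤) (hE : TodaLoop.IsChevalleyBasis 𝔥 α E)
    (hreal : TodaLoop.IsIwasawaCompatible 𝔥 α E)
    (φ : Circle → Matrix (Fin n) (Fin n) ℂ)
    (hToda : (φ, (1 : ℂ)) ∈ TodaLoop.todaPhaseSpace w 𝔥 α θ E)
    (hreg : TodaLoop.LoopRegular 𝔥 (φ, (1 : ℂ))) :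
    ∃ γ ∈ TodaLoop.KTilde w 𝔤, ∃ μ ∈ TodaLoop.aAlg 𝔥 E,
      (φ, (1 : ℂ)) = TodaLoop.gauge γ ((fun _ => μ), (1 : ℂ)) := by
  obtain ⟨⟨⟨x, s⟩, ⟨⟨⟨hxA, hxg⟩, hxk⟩, -⟩, hφ⟩, -⟩ := hToda
  obtain ⟨-, f, ⟨hfG, hf0, hfd⟩, hfreg⟩ := hreg
  dsimp only at hxk hxA
  have hφx : ∀ z, φ z = Complex.I • x z := fun z => congrFun (congrArg Prod.fst hφ) z
  have hfx : ∀ t : ℝ, TodaLoop.HasMatDeriv (fun t => (f t : TodaLoop.Mat n))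
      (x (Circle.exp t) * (f t : TodaLoop.Mat n)) t := by
    intro t i j
    refine (hfd t i j).congr_deriv ?_
    dsimp only
    rw [hφx, smul_smul, mul_one, one_div, inv_mul_cancel₀ Complex.I_ne_zero, one_smul]
  have hfu : ∀ t, (f t : TodaLoop.Mat n)ᴴ * (f t : TodaLoop.Mat n) = 1 := by
    intro t
    rw [TodaLoop.conjTranspose_mul_eq_of_skew (fun t => hxk (Circle.exp t)) hfx hfx t 0, hf0]
    simp
  set M := f (2 * Real.pi) with hM
  have hper : ∀ t, (f (t + 2 * Real.pi) : TodaLoop.Mat n) =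
      (f t : TodaLoop.Mat n) * (M : TodaLoop.Mat n) := by
    intro t
    have hF : ∀ t : ℝ, TodaLoop.HasMatDeriv (fun t => (f (t + 2 * Real.pi) : TodaLoop.Mat n))
        (x (Circle.exp t) * (f (t + 2 * Real.pi) : TodaLoop.Mat n)) t := by
      intro t i j
      have := (hfx (t + 2 * Real.pi) i j).comp_add_const t (2 * Real.pi)
      rwa [Circle.exp_add, Circle.exp_two_pi, mul_one] at this
    -- `f` and its translate by `2π` solve the same periodic system, so `f(t)ᴴ f(t + 2π)` keeps its
    -- value `M` at `t = 0`.
    have h := TodaLoop.conjTranspose_mul_eq_of_skew (fun t => hxk (Circle.exp t)) hfx hF t 0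
    rw [zero_add, hf0, Matrix.SpecialLinearGroup.coe_one, Matrix.conjTranspose_one,
      Matrix.one_mul] at h
    rw [hM, ← h, ← Matrix.mul_assoc, mul_eq_one_comm.1 (hfu t), Matrix.one_mul]
  obtain ⟨k, hkG, hku, z, hz, hMk⟩ := TodaLoop.exists_unitary_conj_of_isRegular hsl hcartan hα hE
    hreal (hfG _) (hfu (2 * Real.pi)) hfreg
  -- Chosen so that `exp (2π i m) = exp (-i z)` cancels the diagonalized monodromy.
  set m : Fin n → ℝ := fun i => -(z i) / (2 * Real.pi) with hm
  have hμ : (Matrix.diagonal fun i => (m i : ℂ)) ∈ TodaLoop.aAlg 𝔥 E := by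
    convert (TodaLoop.aAlg 𝔥 E).smul_mem (-(2 * Real.pi)⁻¹) hz using 1
    rw [← Matrix.diagonal_smul]
    congr 1
    ext i
    simp [hm]
    ring
  have hd : ∀ t : ℝ, ∃ d ∈ TodaLoop.G 𝔤, (d : TodaLoop.Mat n) =
      Matrix.diagonal fun i => Complex.exp (Complex.I * (t * m i)) := by
    intro t
    refine TodaLoop.exists_coe_eq_diagonal_exp hsl ?_
    convert 𝔤.smul_mem (Complex.I * t) (TodaLoop.aAlg_le _ hμ) using 1
    rw [← Matrix.diagonal_smul]
    congr 1
    ext i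
    simp [mul_assoc]
  choose d hdG hdc using hd
  have hdu : ∀ t, (d t : TodaLoop.Mat n)ᴴ * (d t : TodaLoop.Mat n) = 1 := by
    intro t
    rw [hdc, Matrix.diagonal_conjTranspose, Matrix.diagonal_mul_diagonal, ← Matrix.diagonal_one]
    congr 1
    ext i
    rw [Pi.star_apply, Complex.star_def, ← Complex.exp_conj, ← Complex.exp_add]
    simp
  set g : ℝ → TodaLoop.SLn n := fun t => f t * k * d t with hg
  have hgc : ∀ t, (g t : TodaLoop.Mat n) =
      (f t : TodaLoop.Mat n) * (k : TodaLoop.Mat n) * (d t : TodaLoop.Mat n) := by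
    intro t
    rw [hg, Matrix.SpecialLinearGroup.coe_mul, Matrix.SpecialLinearGroup.coe_mul]
  have hgu : ∀ t, (g t : TodaLoop.Mat n)ᴴ * (g t : TodaLoop.Mat n) = 1 := by
    intro t
    rw [hgc, Matrix.conjTranspose_mul, Matrix.conjTranspose_mul]
    calc _ = (d t : TodaLoop.Mat n)ᴴ * ((k : TodaLoop.Mat n)ᴴ * ((f t : TodaLoop.Mat n)ᴴ *
          (f t : TodaLoop.Mat n)) * (k : TodaLoop.Mat n)) * (d t : TodaLoop.Mat n) := by
          simp only [Matrix.mul_assoc]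
      _ = 1 := by rw [hfu, Matrix.mul_one, hku, Matrix.mul_one, hdu]
  have hgper : Function.Periodic g (2 * Real.pi) := by
    intro t
    refine Subtype.ext ?_
    change (g (t + 2 * Real.pi) : TodaLoop.Mat n) = (g t : TodaLoop.Mat n)
    rw [hgc, hgc, hper, Matrix.mul_assoc (f t : TodaLoop.Mat n), hMk, hdc, hdc,
      Matrix.mul_assoc, Matrix.mul_assoc, Matrix.mul_assoc, Matrix.diagonal_mul_diagonal]
    congr 3
    ext i
    rw [← Complex.exp_add]
    congr 1
    have hpi : (Real.pi : ℂ) ≠ 0 := by exact_mod_cast Real.pi_ne_zero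
    simp only [hm]
    push_cast
    field_simp
    ring
  -- The choice of argument is immaterial because `g` is `2π`-periodic.
  set γ : Circle → TodaLoop.SLn n := fun ζ => g (Complex.arg ζ) with hγ
  have hγg : ∀ t : ℝ, γ (Circle.exp t) = g t := by
    intro t
    obtain ⟨N, hN⟩ := Circle.exp_eq_exp.1 (Circle.exp_arg (Circle.exp t))
    rw [hγ]
    simp only
    rw [hN]
    exact hgper.int_mul N t
  have hgd : ∀ t : ℝ, TodaLoop.HasMatDeriv (fun t => (g t : TodaLoop.Mat n))
      (x (Circle.exp t) * (g t : TodaLoop.Mat n) +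
        (g t : TodaLoop.Mat n) * Matrix.diagonal fun i => Complex.I * m i) t := by
    intro t
    have h := ((hfx t).mul_const (k : TodaLoop.Mat n)).mul (TodaLoop.hasMatDeriv_diagonal_exp m t)
    simp only [← hdc] at h
    simp only [hgc]
    simpa only [Matrix.mul_assoc] using h
  have hγu : ∀ ζ, (γ ζ : TodaLoop.Mat n)ᴴ * (γ ζ : TodaLoop.Mat n) = 1 := fun ζ => hgu _
  have hγA : (fun ζ => (γ ζ : TodaLoop.Mat n)) ∈ TodaLoop.MnA w := by
    refine TodaLoop.mem_MnA_of_hasMatDeriv hw hxA (fun i => Complex.I * m i) fun t => ?_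
    simp only [hγg]
    exact hgd t
  refine ⟨γ, ⟨⟨hγA, fun ζ => mul_mem (mul_mem (hfG _) hkG) (hdG _)⟩, fun ζ =>
    Matrix.mem_unitaryGroup_iff'.2 (hγu ζ)⟩, _, hμ, ?_⟩
  refine Prod.ext (funext fun ζ => ?_) rfl
  obtain ⟨t, rfl⟩ := Circle.exp_surjective ζ
  -- By unitarity `γ⁻¹ = γᴴ`, so `D γ⁻¹` is `-i` times the conjugate transpose of `γ'`.
  have hD : TodaLoop.loopD (fun ζ => (((γ ζ)⁻¹ : TodaLoop.SLn n) : TodaLoop.Mat n))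
      (Circle.exp t) = -Complex.I • (x (Circle.exp t) * (g t : TodaLoop.Mat n) +
        (g t : TodaLoop.Mat n) * Matrix.diagonal fun i => Complex.I * m i)ᴴ := by
    ext i j
    rw [TodaLoop.loopD, Matrix.of_apply, Matrix.smul_apply, smul_eq_mul]
    congr 1
    have h1 : (fun s : ℝ => (((γ (Circle.exp t * Circle.exp s))⁻¹ : TodaLoop.SLn n) :
        TodaLoop.Mat n) i j) = fun s => (g (t + s) : TodaLoop.Mat n)ᴴ i j := by
      ext s
      rw [TodaLoop.coe_inv_of_unitary (hγu _), ← Circle.exp_add, hγg]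
    rw [h1]
    have h2 := (hgd t).conjTranspose i j
    rw [← add_zero t] at h2
    have h3 := h2.comp_const_add t 0
    rw [add_zero] at h3
    exact h3.deriv
  change φ (Circle.exp t) = (γ (Circle.exp t) : TodaLoop.Mat n) * (Matrix.diagonal fun i => (m i : ℂ)) *
    (((γ (Circle.exp t))⁻¹ : TodaLoop.SLn n) : TodaLoop.Mat n) + (1 : ℂ) •
      ((γ (Circle.exp t) : TodaLoop.Mat n) *
        TodaLoop.loopD (fun ζ => (((γ ζ)⁻¹ : TodaLoop.SLn n) : TodaLoop.Mat n)) (Circle.exp t))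
  have hgu' : (g t : TodaLoop.Mat n) * (g t : TodaLoop.Mat n)ᴴ = 1 := mul_eq_one_comm.1 (hgu t)
  have hdm : (Matrix.diagonal fun i => Complex.I * m i : TodaLoop.Mat n)ᴴ =
      -Complex.I • Matrix.diagonal fun i => (m i : ℂ) := by
    rw [Matrix.diagonal_conjTranspose, ← Matrix.diagonal_smul]
    congr 1
    ext i
    simp
  -- Expanding gives `γ Dγ⁻¹ = i x - γ μ γᴴ`; the last term cancels `γ μ γ⁻¹` and leaves `i x = φ`.
  rw [hD, TodaLoop.coe_inv_of_unitary (hγu _), hγg, hφx, one_smul, Matrix.conjTranspose_add,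
    Matrix.conjTranspose_mul, Matrix.conjTranspose_mul, hxk, hdm, Matrix.mul_smul, Matrix.mul_add,
    ← Matrix.mul_assoc, hgu', Matrix.one_mul, Matrix.smul_mul, Matrix.mul_smul, smul_add, smul_smul,
    neg_mul_neg, Complex.I_mul_I, smul_neg, neg_smul, neg_neg, neg_smul, one_smul,
    ← Matrix.mul_assoc]
  abel
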